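/- A linear reservoir system of dimensions $(n,m,d)$ is a triple $R=(W,V,h)$ with $W\in\mathbb{R}^{n\times n}$ of operator norm $\|W\|<1$, $V\in\mathbb{R}^{n\times m}$, and $h:\mathbb{R}^n\to\mathbb{R}^d$ continuous. For an input stream $u=\{u_t\}_{t\in\mathbb{Z}_-}\subset\mathbb{R}^m$, uniformly bounded by a fixed constant $M$ ($\|u_t\|_2\le M$ for all $t$), its states and outputs are $x_t(u)=\sum_{k\ge 0}W^kVu_{t-k}$ and $y_t(u)=h(x_t(u))$; this is the unique bounded solution of $x_t=Wx_{t-1}+Vu_t$. Two reservoir systems of dimensions $(n,m,d)$ and $(n',m,d)$, with outputs $y_t$ and $y'_t$, are $\epsilon$-close if $\|y_t(u)-y'_t(u)\|_2<\epsilon$ for every input stream $u$ bounded by $M$ and every $t\in\mathbb{Z}_-$. A matrix is a contractive full-cycle permutation if it equals $cP$ with $c\in(0,1)$ and $P$ the permutation matrix of a single cycle through all the indices. Theorem. Let $n\ge 1$, let $U$ be an $n\times n$ orthogonal matrix, let $\lambda\in(0,1)$, and let $R=(W,V,h)$ be a linear reservoir system of dimensions $(n,m,d)$ with $W=\lambda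 U$. Let $M$ be the uniform bound on the input streams. Then for every $\epsilon>0$ there exist $n'$ and a linear reservoir system $R_c=(W_c,V_c,h_c)$ of dimensions $(n',m,d)$ that is $\epsilon$-close to $R$ such that: 1. $W_c$ is a contractive full-cycle permutation with $\|W_c\|=\|W\|=\lambda$; and 2. $h_c$ is $h$ with linearly transformed domain, that is, there is an $n\times n'$ real matrix $A$ with $h_c(x)=h(Ax)$ for all $x\in\mathbb{R}^{n'}$. -/

import Mathlib

open scoped Matrix.Norms.L2Operator

/-- The linear map `x ↦ A x` between Euclidean spaces given by a real matrix `A`. -/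
noncomputable abbrev Matrix.act {k l : ℕ} (A : Matrix (Fin k) (Fin l) ℝ) :
    EuclideanSpace ℝ (Fin l) →L[ℝ] EuclideanSpace ℝ (Fin k) :=
  LinearMap.toContinuousLinearMap (Matrix.toLpLin 2 2 A)

/-- A linear reservoir system `(W, V, h)` over `ℝ` of dimensions `(n, m, d)`: a dynamic coupling `W`
whose operator norm (with respect to Euclidean norms) is less than one, an input-to-state coupling
`V` and a continuous readout `h`. -/
structure LinearReservoir (n m d : ℕ) where
  W : Matrix (Fin n) (Fin n) ℝ
  V : Matrix (Fin n) (Fin m) ℝ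
  h : EuclideanSpace ℝ (Fin n) → EuclideanSpace ℝ (Fin d)
  norm_W_lt_one : ‖W‖ < 1
  continuous_h : Continuous h

/-- The set `ℤ₋` of times `t ≤ 0`. -/
abbrev NegTime : Type := {t : ℤ // t ≤ 0}

/-- The time `t - k`. -/
def NegTime.back (t : NegTime) (k : ℕ) : NegTime :=
  ⟨t.1 - k, by have := t.2; omega⟩

/-- A left-infinite input stream in `ℝᵐ`. -/
abbrev InputStream (m : ℕ) : Type := NegTime → EuclideanSpace ℝ (Fin m)

namespace LinearReservoir

variable {n m d : ℕ}

/-- The state `x_t(u) = ∑_{k ≥ 0} Wᵏ V u_{t-k}`. For bounded inputs the series converges, see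
`summable_state`, and this is the only bounded solution of `x_t = W x_{t-1} + V u_t`, see
`eq_state_iff`. -/
noncomputable def state (R : LinearReservoir n m d) (u : InputStream m) (t : NegTime) :
    EuclideanSpace ℝ (Fin n) :=
  ∑' k : ℕ, (R.W ^ k * R.V).act (u (t.back k))

/-- The output `y_t(u) = h(x_t(u))`. -/
noncomputable def output (R : LinearReservoir n m d) (u : InputStream m) (t : NegTime) :
    EuclideanSpace ℝ (Fin d) :=
  R.h (R.state u t)

/-- `R` and `R'` are `ε`-close, for input streams uniformly bounded by the constant `M`. -/
def IsClose {n' : ℕ} (M ε : ℝ) (R : LinearReservoir n m d) (R' : LinearReservoir n' m d) : Prop :=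
  ∀ u : InputStream m, (∀ t, ‖u t‖ ≤ M) → ∀ t, ‖R.output u t - R'.output u t‖ < ε

end LinearReservoir

/-- `P` is the matrix of a permutation that is a single cycle through all the `n` indices.
(`IsCycleOn` is used so that the identity of a one-point set counts as a cycle of length one.) -/
def IsFullCyclePermutation {n : ℕ} (P : Matrix (Fin n) (Fin n) ℝ) : Prop :=
  ∃ σ : Equiv.Perm (Fin n), σ.IsCycleOn Set.univ ∧ ∀ i j, P i j = if σ i = j then 1 else 0

/-- `W = c P` with `c ∈ (0, 1)` and `P` a full-cycle permutation matrix. -/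
def IsContractiveFullCycle {n : ℕ} (W : Matrix (Fin n) (Fin n) ℝ) : Prop :=
  ∃ (c : ℝ) (P : Matrix (Fin n) (Fin n) ℝ), 0 < c ∧ c < 1 ∧ IsFullCyclePermutation P ∧ W = c • P

/-- `g` is `h` with linearly transformed domain: `g(x) = h(A x)` for some matrix `A`. -/
def IsLinearlyTransformed {n n' d : ℕ}
    (g : EuclideanSpace ℝ (Fin n') → EuclideanSpace ℝ (Fin d))
    (h : EuclideanSpace ℝ (Fin n) → EuclideanSpace ℝ (Fin d)) : Prop :=
  ∃ A : Matrix (Fin n) (Fin n') ℝ, ∀ x, g x = h (A.act x)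

section Solution

theorem Matrix.norm_act_le {k l : ℕ} (A : Matrix (Fin k) (Fin l) ℝ)
    (x : EuclideanSpace ℝ (Fin l)) : ‖A.act x‖ ≤ ‖A‖ * ‖x‖ :=
  Matrix.l2_opNorm_mulVec A x

theorem Matrix.act_mul {j k l : ℕ} (A : Matrix (Fin j) (Fin k) ℝ) (B : Matrix (Fin k) (Fin l) ℝ)
    (x : EuclideanSpace ℝ (Fin l)) : (A * B).act x = A.act (B.act x) := by
  ext i
  simp [Matrix.act, Matrix.toLpLin_apply]

theorem Matrix.act_one {k : ℕ} (x : EuclideanSpace ℝ (Fin k)) :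
    (1 : Matrix (Fin k) (Fin k) ℝ).act x = x := by
  ext i
  simp [Matrix.act]

namespace LinearReservoir

variable {n m d : ℕ} (R : LinearReservoir n m d) {u : InputStream m} {M : ℝ}

theorem norm_pow_act_le (x : EuclideanSpace ℝ (Fin n)) (k : ℕ) :
    ‖(R.W ^ k).act x‖ ≤ ‖R.W‖ ^ k * ‖x‖ := by
  induction k with
  | zero => simp only [pow_zero, Matrix.act_one, one_mul, le_refl]
  | succ k ih =>
    rw [pow_succ', Matrix.act_mul, pow_succ', mul_assoc]
    exact (Matrix.norm_act_le _ _).trans (mul_le_mul_of_nonneg_left ih (norm_nonneg _))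

theorem norm_term_le (hu : ∀ t, ‖u t‖ ≤ M) (t : NegTime) (k : ℕ) :
    ‖(R.W ^ k * R.V).act (u (t.back k))‖ ≤ ‖R.W‖ ^ k * (‖R.V‖ * M) := by
  rw [Matrix.act_mul]
  exact (R.norm_pow_act_le _ k).trans (mul_le_mul_of_nonneg_left
    ((Matrix.norm_act_le _ _).trans (mul_le_mul_of_nonneg_left (hu _) (norm_nonneg _)))
    (by positivity))

theorem summable_bound : Summable fun k : ℕ => ‖R.W‖ ^ k * (‖R.V‖ * M) :=
  (summable_geometric_of_lt_one (norm_nonneg _) R.norm_W_lt_one).mul_right _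

theorem summable_state (hu : ∀ t, ‖u t‖ ≤ M) (t : NegTime) :
    Summable fun k : ℕ => (R.W ^ k * R.V).act (u (t.back k)) :=
  R.summable_bound.of_norm_bounded (R.norm_term_le hu t)

theorem norm_state_le (hu : ∀ t, ‖u t‖ ≤ M) (t : NegTime) :
    ‖R.state u t‖ ≤ ∑' k : ℕ, ‖R.W‖ ^ k * (‖R.V‖ * M) :=
  tsum_of_norm_bounded R.summable_bound.hasSum (R.norm_term_le hu t)

theorem state_eq (hu : ∀ t, ‖u t‖ ≤ M) (t : NegTime) :
    R.state u t = R.W.act (R.state u (t.back 1)) + R.V.act (u t) := by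
  have h0 : t.back 0 = t := by simp [NegTime.back]
  have h1 : ∀ k : ℕ, t.back (k + 1) = (t.back 1).back k := fun k => by
    apply Subtype.ext; simp only [NegTime.back]; push_cast; ring
  rw [state, (R.summable_state hu t).tsum_eq_zero_add, add_comm, state,
    ContinuousLinearMap.map_tsum _ (R.summable_state hu (t.back 1))]
  congr 1
  · refine tsum_congr fun k => ?_
    rw [h1, ← Matrix.act_mul, ← Matrix.mul_assoc, ← pow_succ']
  · rw [h0, pow_zero, Matrix.one_mul]

/-- For an input bounded by `M`, the states `x_t(u)` form the unique bounded solution of the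
linear dynamical system. -/
theorem eq_state_iff (hu : ∀ t, ‖u t‖ ≤ M) (x : NegTime → EuclideanSpace ℝ (Fin n)) :
    x = R.state u ↔
      (∃ C, ∀ t, ‖x t‖ ≤ C) ∧ ∀ t, x t = R.W.act (x (t.back 1)) + R.V.act (u t) := by
  constructor
  · rintro rfl
    exact ⟨⟨_, R.norm_state_le hu⟩, R.state_eq hu⟩
  · rintro ⟨⟨C, hC⟩, hx⟩
    set C' := ∑' k : ℕ, ‖R.W‖ ^ k * (‖R.V‖ * M) with hC'
    have key : ∀ (k : ℕ) (t : NegTime), ‖x t - R.state u t‖ ≤ ‖R.W‖ ^ k * (C + C') := by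
      intro k
      induction k with
      | zero =>
        intro t
        rw [pow_zero, one_mul]
        exact (norm_sub_le _ _).trans (add_le_add (hC t) (R.norm_state_le hu t))
      | succ k ih =>
        intro t
        rw [hx t, R.state_eq hu t, add_sub_add_right_eq_sub, ← map_sub, pow_succ', mul_assoc]
        exact (Matrix.norm_act_le _ _).trans
          (mul_le_mul_of_nonneg_left (ih _) (norm_nonneg _))
    funext t
    have hlim := (tendsto_pow_atTop_nhds_zero_of_lt_one (norm_nonneg R.W)
      R.norm_W_lt_one).mul_const (C + C')
    rw [zero_mul] at hlim
    have := ge_of_tendsto' hlim (fun k => key k t)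
    exact sub_eq_zero.1 (norm_le_zero_iff.1 this)

end LinearReservoir

end Solution

/-! A scaled cyclic shift can serve as a delay line. Give each of the `m` input coordinates a block
of `K` consecutive sites on one cycle: coordinate `j` enters at site `j K`, and after `k < K` steps
it sits, scaled by `λ ^ k`, at site `j K + k`. A linear readout with column `U ^ k V e_j` at that
site recovers `W ^ k V e_j` exactly (`delayReadout_mul_eq`). Older inputs leave their block and are
decoded wrongly, but every readout column has norm at most `‖V‖`, so the error is `O(λ ^ K)` with a
constant independent of `K` (`norm_delay_act_le`). As the states of `R` stay in a compact ball,
uniform continuity of `h` turns this into closeness of outputs. -/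

theorem isCycleOn_finRotate_succ (N : ℕ) :
    (finRotate (N + 1)).IsCycleOn (Set.univ : Set (Fin (N + 1))) := by
  rcases N with _ | N
  · have : Subsingleton (Fin (0 + 1)) := inferInstanceAs (Subsingleton (Fin 1))
    exact Equiv.Perm.isCycleOn_of_subsingleton _ _
  · have h := (isCycle_finRotate (n := N)).isCycleOn
    have hs : {x | finRotate (N + 2) x ≠ x} = Set.univ := by
      ext x
      simp
    rwa [hs] at h

/-- The matrix of the cyclic shift `e_i ↦ e_{i+1}`. -/
noncomputable def cyclicShift (N : ℕ) : Matrix (Fin (N + 1)) (Fin (N + 1)) ℝ :=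
  -- The permutation matrix of `σ` sends `e_j` to `e_{σ⁻¹ j}`, hence the inverse.
  Equiv.Perm.permMatrix ℝ (finRotate (N + 1))⁻¹

theorem isFullCyclePermutation_cyclicShift (N : ℕ) : IsFullCyclePermutation (cyclicShift N) := by
  refine ⟨(finRotate (N + 1))⁻¹, Equiv.Perm.isCycleOn_inv.2 (isCycleOn_finRotate_succ N),
    fun i j => ?_⟩
  simp [cyclicShift, Equiv.Perm.permMatrix, PEquiv.toMatrix_apply, eq_comm]

theorem norm_cyclicShift (N : ℕ) : ‖cyclicShift N‖ = 1 :=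
  Matrix.permMatrix_l2_opNorm_eq _

theorem cyclicShift_act_single (N : ℕ) (i : Fin (N + 1)) :
    (cyclicShift N).act (EuclideanSpace.single i 1) = EuclideanSpace.single (i + 1) 1 := by
  ext l
  have h : l - 1 = i ↔ l = i + 1 := sub_eq_iff_eq_add
  simp [cyclicShift, Matrix.act, Matrix.toLpLin_apply, Equiv.Perm.inv_def, h]

theorem cyclicShift_pow_act_single (N k : ℕ) (i : Fin (N + 1)) :
    (cyclicShift N ^ k).act (EuclideanSpace.single i 1) =
      EuclideanSpace.single (i + Fin.ofNat (N + 1) k) 1 := by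
  induction k with
  | zero => simp [Matrix.act_one]
  | succ k ih =>
    rw [pow_succ', Matrix.act_mul, ih, cyclicShift_act_single, add_assoc]
    congr 2
    exact Fin.ext (by simp [Fin.val_add])

theorem Matrix.act_smul {k l : ℕ} (c : ℝ) (A : Matrix (Fin k) (Fin l) ℝ)
    (x : EuclideanSpace ℝ (Fin l)) : (c • A).act x = c • A.act x := by
  simp [Matrix.act]

theorem Matrix.act_eq_sum {k l : ℕ} (A : Matrix (Fin k) (Fin l) ℝ)
    (x : EuclideanSpace ℝ (Fin l)) :
    A.act x = ∑ j, x j • A.act (EuclideanSpace.single j 1) := by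
  conv_lhs => rw [← (EuclideanSpace.basisFun (Fin l) ℝ).sum_repr x]
  rw [map_sum]
  exact Finset.sum_congr rfl fun j _ => by rw [map_smul]; simp

/-- A crude columnwise bound suffices: it is applied with `l = m`, which does not grow with `K`. -/
theorem Matrix.norm_act_le_of_forall_single {k l : ℕ} (A : Matrix (Fin k) (Fin l) ℝ) {c : ℝ}
    (hA : ∀ j, ‖A.act (EuclideanSpace.single j 1)‖ ≤ c) (x : EuclideanSpace ℝ (Fin l)) :
    ‖A.act x‖ ≤ l * (‖x‖ * c) := by
  rw [Matrix.act_eq_sum]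
  calc ‖∑ j, x j • A.act (EuclideanSpace.single j 1)‖
      ≤ ∑ j : Fin l, ‖x‖ * c := norm_sum_le_of_le _ fun j _ => by
        rw [norm_smul]
        exact mul_le_mul (PiLp.norm_apply_le x j) (hA j) (norm_nonneg _) (norm_nonneg _)
    _ = l * (‖x‖ * c) := by simp

theorem Matrix.act_of_single {k l : ℕ} (f : Fin l → EuclideanSpace ℝ (Fin k)) (j : Fin l) :
    (Matrix.of fun i j => f j i).act (EuclideanSpace.single j 1) = f j := by
  ext i
  simp [Matrix.act, Matrix.toLpLin_apply]

theorem Matrix.eq_of_act_single_eq {k l : ℕ} {A B : Matrix (Fin k) (Fin l) ℝ}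
    (h : ∀ j, A.act (EuclideanSpace.single j 1) = B.act (EuclideanSpace.single j 1)) : A = B := by
  ext i j
  simpa [Matrix.act, Matrix.toLpLin_apply] using
    congrArg (fun v : EuclideanSpace ℝ (Fin k) => v i) (h j)

theorem norm_of_mem_orthogonalGroup {n : ℕ} (hn : 0 < n) {U : Matrix (Fin n) (Fin n) ℝ}
    (hU : U ∈ Matrix.orthogonalGroup (Fin n) ℝ) : ‖U‖ = 1 :=
  have : Nonempty (Fin n) := ⟨⟨0, hn⟩⟩
  CStarRing.norm_of_mem_unitary hU

/-! ### Delay line on a cycle and its linear decoding -/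

section DelayLine

variable {n m : ℕ} (U : Matrix (Fin n) (Fin n) ℝ) (V : Matrix (Fin n) (Fin m) ℝ) (K : ℕ)

/-- The vector `U ^ r V e_j` decoded from the index `i = j K + r`, and zero beyond the last block. -/
noncomputable def delayVector (i : ℕ) : EuclideanSpace ℝ (Fin n) :=
  if h : i / K < m then (U ^ (i % K) * V).act (EuclideanSpace.single ⟨i / K, h⟩ 1) else 0

/-- The matrix whose column `j K + r` is `U ^ r V e_j` for `r < K`. -/
noncomputable def delayReadout : Matrix (Fin n) (Fin (m * K + 1)) ℝ :=
  Matrix.of fun l i => delayVector U V K i l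

/-- The matrix that feeds the `j`-th input into the index `j K`. -/
noncomputable def delayInput (m K : ℕ) : Matrix (Fin (m * K + 1)) (Fin m) ℝ :=
  Matrix.of fun l j => (EuclideanSpace.single (Fin.ofNat (m * K + 1) (j * K)) (1 : ℝ) :
    EuclideanSpace ℝ (Fin (m * K + 1))) l

theorem delayReadout_cyclicShift_pow_delayInput (k : ℕ) (j : Fin m) :
    (delayReadout U V K * (cyclicShift (m * K) ^ k * delayInput m K)).act
      (EuclideanSpace.single j 1) = delayVector U V K ((j * K + k) % (m * K + 1)) := by
  rw [Matrix.act_mul, Matrix.act_mul, delayInput, Matrix.act_of_single,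
    cyclicShift_pow_act_single, delayReadout,
    Matrix.act_of_single (fun i : Fin (m * K + 1) => delayVector U V K i)]
  simp [Fin.val_add]

variable {K} in
theorem delayReadout_mul_eq {k : ℕ} (hk : k < K) :
    delayReadout U V K * (cyclicShift (m * K) ^ k * delayInput m K) = U ^ k * V := by
  refine Matrix.eq_of_act_single_eq fun j => ?_
  -- A signal younger than `K` is still in its own block, so it has not wrapped around the cycle.
  have h1 : (j : ℕ) * K + k < m * K := by
    have := Nat.mul_le_mul_right K (Nat.succ_le_of_lt j.2)
    rw [Nat.succ_mul] at this
    omega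
  have h2 : ((j : ℕ) * K + k) / K = j := by
    rw [mul_comm, Nat.mul_add_div (by omega), Nat.div_eq_of_lt hk, add_zero]
  have h3 : ((j : ℕ) * K + k) % K = k := by
    rw [mul_comm, Nat.mul_add_mod, Nat.mod_eq_of_lt hk]
  rw [delayReadout_cyclicShift_pow_delayInput, Nat.mod_eq_of_lt (by omega), delayVector]
  simp only [h2, h3, j.2, dif_pos]

variable {U} in
theorem norm_delayVector_le (hU : ‖U‖ ≤ 1) (i : ℕ) : ‖delayVector U V K i‖ ≤ ‖V‖ := by
  unfold delayVector
  split_ifs with h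
  · have hpow : ∀ (r : ℕ) (x : EuclideanSpace ℝ (Fin n)), ‖(U ^ r).act x‖ ≤ ‖x‖ := by
      intro r
      induction r with
      | zero => simp [Matrix.act_one]
      | succ r ih =>
        intro x
        rw [pow_succ', Matrix.act_mul]
        refine (Matrix.norm_act_le _ _).trans ((mul_le_mul hU (ih x) (norm_nonneg _)
          zero_le_one).trans (one_mul _).le)
    rw [Matrix.act_mul]
    refine (hpow _ _).trans ((Matrix.norm_act_le _ _).trans ?_)
    simp
  · simp

variable {U} in
-- Even after leaving its block or wrapping around, a unit input occupies a single site, so the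
-- readout sees one column. Bounding by `‖delayReadout U V K‖` instead could bring in a dependence
-- on `K`.
theorem norm_delay_act_le (hU : ‖U‖ ≤ 1) (k : ℕ) (x : EuclideanSpace ℝ (Fin m)) :
    ‖(delayReadout U V K * (cyclicShift (m * K) ^ k * delayInput m K)).act x‖ ≤
      m * (‖x‖ * ‖V‖) :=
  Matrix.norm_act_le_of_forall_single _ (fun j => by
    rw [delayReadout_cyclicShift_pow_delayInput]
    exact norm_delayVector_le V K hU _) x

end DelayLine

/-- A continuous function on a proper space is uniformly continuous near each closed ball. -/
theorem Continuous.exists_dist_lt_of_mem_closedBall {X Y : Type*} [PseudoMetricSpace X]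
    [ProperSpace X] [PseudoMetricSpace Y] {f : X → Y} (hf : Continuous f) (x₀ : X) (B : ℝ) {ε : ℝ}
    (hε : 0 < ε) :
    ∃ δ > 0, ∀ x ∈ Metric.closedBall x₀ B, ∀ y, dist x y < δ → dist (f x) (f y) < ε := by
  have h := (isCompact_closedBall x₀ B).uniformContinuousAt_of_continuousAt f
    (fun a _ => hf.continuousAt) (Metric.dist_mem_uniformity hε)
  obtain ⟨δ, hδ, hsub⟩ := Metric.mem_uniformity_dist.1 h
  exact ⟨δ, hδ, fun x hx y hxy => hsub hxy hx⟩

/-! ### Approximation of the states and outputs -/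

namespace LinearReservoir

variable {n m d : ℕ}

/-- The reservoir whose state is a delay line on a single cycle, storing the last inputs. -/
noncomputable def delayLine (R : LinearReservoir n m d) (U : Matrix (Fin n) (Fin n) ℝ)
    (lam : ℝ) (hlam0 : 0 < lam) (hlam1 : lam < 1) (K : ℕ) :
    LinearReservoir (m * K + 1) m d where
  W := lam • cyclicShift (m * K)
  V := delayInput m K
  h x := R.h ((delayReadout U R.V K).act x)
  norm_W_lt_one := by
    rwa [norm_smul, norm_cyclicShift, mul_one, Real.norm_of_nonneg hlam0.le]
  continuous_h := R.continuous_h.comp (delayReadout U R.V K).act.continuous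

theorem norm_state_sub_delayLine_le (R : LinearReservoir n m d) {U : Matrix (Fin n) (Fin n) ℝ}
    (hU : ‖U‖ ≤ 1) {lam : ℝ} (hlam0 : 0 < lam) (hlam1 : lam < 1) (hR : R.W = lam • U) {M : ℝ}
    (K : ℕ) {u : InputStream m} (hu : ∀ t, ‖u t‖ ≤ M) (t : NegTime) :
    ‖R.state u t - (delayReadout U R.V K).act ((R.delayLine U lam hlam0 hlam1 K).state u t)‖ ≤
      lam ^ K * (((1 - lam)⁻¹) * (‖R.V‖ * M + m * (M * ‖R.V‖))) := by
  set Rc := R.delayLine U lam hlam0 hlam1 K with hRc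
  set A := delayReadout U R.V K
  have hW : ‖R.W‖ ≤ lam := by
    rw [hR, norm_smul, Real.norm_of_nonneg hlam0.le]
    exact mul_le_of_le_one_right hlam0.le hU
  have hM : 0 ≤ M := (norm_nonneg _).trans (hu t)
  have hsA : Summable fun k : ℕ => A.act ((Rc.W ^ k * Rc.V).act (u (t.back k))) :=
    A.act.summable (Rc.summable_state hu t)
  have hterm : ∀ k : ℕ, A.act ((Rc.W ^ k * Rc.V).act (u (t.back k))) =
      lam ^ k • (A * (cyclicShift (m * K) ^ k * delayInput m K)).act (u (t.back k)) := fun k => by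
    rw [← Matrix.act_mul, ← Matrix.act_smul, hRc, delayLine, smul_pow, Matrix.smul_mul,
      Matrix.mul_smul]
  have hzero : ∀ k < K, (R.W ^ k * R.V).act (u (t.back k)) -
      A.act ((Rc.W ^ k * Rc.V).act (u (t.back k))) = 0 := fun k hk => by
    rw [hterm, delayReadout_mul_eq U R.V hk, hR, smul_pow, Matrix.smul_mul, Matrix.act_smul,
      sub_self]
  have hbound : ∀ k : ℕ, ‖(R.W ^ k * R.V).act (u (t.back k)) -
      A.act ((Rc.W ^ k * Rc.V).act (u (t.back k)))‖ ≤
      lam ^ k * (‖R.V‖ * M + m * (M * ‖R.V‖)) := fun k => by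
    refine (norm_sub_le _ _).trans ?_
    rw [mul_add]
    refine add_le_add ((R.norm_term_le hu t k).trans ?_) ?_
    · gcongr
    · rw [hterm, norm_smul, Real.norm_of_nonneg (by positivity)]
      refine mul_le_mul_of_nonneg_left ((norm_delay_act_le R.V K hU k _).trans ?_) (by positivity)
      gcongr
      exact hu _
  have hsum := (R.summable_state hu t).sub hsA
  rw [state, state, ContinuousLinearMap.map_tsum _ (Rc.summable_state hu t),
    ← (R.summable_state hu t).tsum_sub hsA, ← hsum.sum_add_tsum_nat_add K,
    Finset.sum_eq_zero fun k hk => hzero k (Finset.mem_range.1 hk), zero_add]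
  -- The first `K` terms cancel; the tail is dominated by a geometric series with `λ ^ K` factored
  -- out.
  refine tsum_of_norm_bounded (((hasSum_geometric_of_lt_one hlam0.le hlam1).mul_right _).mul_left _)
    fun k => (hbound (k + K)).trans_eq ?_
  rw [pow_add]
  ring

end LinearReservoir

theorem mainTheorem2 {n m d : ℕ} (hn : 0 < n) (U : Matrix (Fin n) (Fin n) ℝ)
    (hU : U ∈ Matrix.orthogonalGroup (Fin n) ℝ) (lam : ℝ) (hlam0 : 0 < lam) (hlam1 : lam < 1)
    (R : LinearReservoir n m d) (hR : R.W = lam • U) (M : ℝ) (ε : ℝ) (hε : 0 < ε) :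
    ∃ (n' : ℕ) (Rc : LinearReservoir n' m d),
      R.IsClose M ε Rc ∧
      IsContractiveFullCycle Rc.W ∧ ‖Rc.W‖ = ‖R.W‖ ∧ ‖R.W‖ = lam ∧
      IsLinearlyTransformed Rc.h R.h := by
  have hU1 := norm_of_mem_orthogonalGroup hn hU
  have hW : ‖R.W‖ = lam := by
    rw [hR, norm_smul, hU1, mul_one, Real.norm_of_nonneg hlam0.le]
  -- The radius bounds the states of `R` alone, so `δ` is fixed before `K` is chosen.
  obtain ⟨δ, hδ, hδh⟩ := R.continuous_h.exists_dist_lt_of_mem_closedBall 0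
    (∑' k : ℕ, ‖R.W‖ ^ k * (‖R.V‖ * M)) hε
  have hlim := (tendsto_pow_atTop_nhds_zero_of_lt_one hlam0.le hlam1).mul_const
    (((1 - lam)⁻¹) * (‖R.V‖ * M + m * (M * ‖R.V‖)))
  rw [zero_mul] at hlim
  obtain ⟨K, hK⟩ := (hlim.eventually_lt_const hδ).exists
  refine ⟨m * K + 1, R.delayLine U lam hlam0 hlam1 K, fun u hu t => ?_,
    ⟨lam, _, hlam0, hlam1, isFullCyclePermutation_cyclicShift _, rfl⟩, ?_, hW,
    ⟨delayReadout U R.V K, fun _ => rfl⟩⟩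
  · rw [← dist_eq_norm]
    refine hδh _ (mem_closedBall_zero_iff.2 (R.norm_state_le hu t)) _ ?_
    rw [dist_eq_norm]
    exact (R.norm_state_sub_delayLine_le hU1.le hlam0 hlam1 hR K hu t).trans_lt hK
  · rw [hW, LinearReservoir.delayLine, norm_smul, norm_cyclicShift, mul_one,
      Real.norm_of_nonneg hlam0.le]
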